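/- Let $\hbar>0$ and let $\nu$ be a probability measure on $\mathbb R$ (the distribution of random momentum kicks) that is not a point mass; for instance $d\nu=\tilde g(p)\,dp$ with a probability density $\tilde g$. Put $g(\xi)=\int e^{ip\xi/\hbar}\,d\nu(p)$. On the trace-class operators of $\mathcal H=L^2(\mathbb R)$ let $$\Delta_g(T)=\int_{\mathbb R} e^{ipX/\hbar}\,T\,e^{-ipX/\hbar}\,d\nu(p),$$ where $X$ is multiplication by $x$; in the position representation $\Delta_g$ multiplies the kernel $T(x,y)$ by $g(x-y)$. A state is a positive trace-class operator of trace one. For a trace-class $\rho$ let $C_2^g(\rho)=\operatorname{Re}\big(\operatorname{Tr}\rho^2-\operatorname{Tr}(\Delta_g\rho)^2\big)$, which for a state is just $\operatorname{Tr}\rho^2-\operatorname{Tr}(\Delta_g\rho)^2$. Let $\mathrm{DIO}_g$ be the set of completely positive trace-preserving linear maps $\Lambda$ on the trace-class operators with $\Lambda\circ\Delta_g=\Delta_g\circ\Lambda$. Let $V_a$ be the translation $(V_a\psi)(x)=\psi(x-a)$ and $P_S$ the multiplication by the indicator function of $S$. Then the following hold. 1. $C_2^g$ is not monotone under $\mathrm{DIO}_g$: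 it is not true that $C_2^g(\Lambda(\rho))\le C_2^g(\rho)$ for all $\Lambda\in\mathrm{DIO}_g$ and all states $\rho$. 2. Let $\varphi\in L^2(\mathbb R)$ with $\|\varphi\|=1$ vanish almost everywhere outside a measurable set $S$, and let $a,b\in\mathbb R$ be such that $A=S+a$ and $B=S+b$ are disjoint. Put $$\Lambda(T)=K_ATK_A^\dagger+K_BTK_B^\dagger+K_0TK_0^\dagger,\qquad K_A=V_{-a}P_A,\quad K_B=V_{-b}P_B,\quad K_0=P_{(A\cup B)^c},$$ $$\rho=\tfrac12|V_a\varphi\rangle\langle V_a\varphi|+\tfrac12|V_b\varphi\rangle\langle V_b\varphi|.$$ Then $\Lambda\in\mathrm{DIO}_g$, $\rho$ is a state, $\Lambda(\rho)=|\varphi\rangle\langle\varphi|$, and $C_2^g(\Lambda(\rho))=2\,C_2^g(\rho)$. 3. There are a unit vector $\varphi\in L^2(\mathbb R)$ that vanishes almost everywhere outside a bounded interval $S=[c,d]$, and $a,b\in\mathbb R$ such that $S+a$ and $S+b$ are disjoint and $C_2^g(|\varphi\rangle\langle\varphi|)>0$. -/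

import Mathlib

noncomputable section

namespace PosCoh

open MeasureTheory InnerProductSpace
open scoped ComplexOrder InnerProductSpace

section Abstract

variable {H : Type} [NormedAddCommGroup H] [InnerProductSpace ℂ H] [CompleteSpace H]

/-- Trace-class operators on a Hilbert space: the operators `T = ∑ₙ |xₙ⟩⟨yₙ|` with
`∑ₙ ‖xₙ‖ ‖yₙ‖ < ∞`. -/
def IsTraceClass (T : H →L[ℂ] H) : Prop :=
  ∃ x y : ℕ → H, Summable (fun n => ‖x n‖ * ‖y n‖) ∧
    HasSum (fun n => rankOne ℂ (x n) (y n)) T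

lemma IsTraceClass.of_index {ι : Type*} {T : H →L[ℂ] H} (x y : ι → H)
    (hs : Summable fun i => ‖x i‖ * ‖y i‖) (hT : HasSum (fun i => rankOne ℂ (x i) (y i)) T) :
    IsTraceClass T := by
  classical
  set s : Set ι := Function.support fun i => ‖x i‖ * ‖y i‖ with hsdef
  have hsc : s.Countable := hs.countable_support
  have : Countable s := hsc.to_subtype
  obtain ⟨e, he⟩ := Countable.exists_injective_nat s
  have h0 : ∀ i, i ∉ s → rankOne ℂ (x i) (y i) = 0 := by
    intro i hi
    have : ‖x i‖ * ‖y i‖ = 0 := by_contra fun hne => hi hne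
    rw [← norm_eq_zero, norm_rankOne, this]
  have hT' : HasSum (fun i : s => rankOne ℂ (x i) (y i)) T := by
    refine (hasSum_subtype_iff_of_support_subset (s := s)
      (f := fun i => rankOne ℂ (x i) (y i)) ?_).2 hT
    intro i hi
    by_contra h
    exact hi (h0 i h)
  have key : ∀ n, rankOne ℂ (Function.extend e (fun i : s => x i) 0 n)
      (Function.extend e (fun i : s => y i) 0 n)
      = Function.extend e (fun i : s => rankOne ℂ (x i) (y i)) 0 n := by
    intro n
    by_cases h : ∃ i, e i = n
    · obtain ⟨i, rfl⟩ := h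
      simp [he.extend_apply]
    · simp [Function.extend_apply' _ _ _ h]
  refine ⟨Function.extend e (fun i : s => x i) 0, Function.extend e (fun i : s => y i) 0, ?_, ?_⟩
  · have : (fun n => ‖Function.extend e (fun i : s => x i) 0 n‖ *
        ‖Function.extend e (fun i : s => y i) 0 n‖)
        = Function.extend e (fun i : s => ‖x i‖ * ‖y i‖) 0 := by
      funext n
      by_cases h : ∃ i, e i = n
      · obtain ⟨i, rfl⟩ := h
        simp [he.extend_apply]
      · simp [Function.extend_apply' _ _ _ h]
    rw [this]
    exact ((hasSum_extend_zero he).2 (hs.subtype s).hasSum).summable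
  · simp_rw [key]
    exact (hasSum_extend_zero he).2 hT'

lemma hasSum_rankOne_of_apply {ι : Type*} {T : H →L[ℂ] H} {x y : ι → H}
    (hs : Summable fun i => ‖x i‖ * ‖y i‖)
    (hT : ∀ v, HasSum (fun i => ⟪y i, v⟫_ℂ • x i) (T v)) :
    HasSum (fun i => rankOne ℂ (x i) (y i)) T := by
  have h1 : Summable fun i => rankOne ℂ (x i) (y i) :=
    Summable.of_norm (by simpa using hs)
  convert h1.hasSum
  ext v
  have h2 := h1.hasSum.mapL (ContinuousLinearMap.apply ℂ H v)
  exact (hT v).unique (by simpa using h2)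

lemma IsTraceClass.zero : IsTraceClass (0 : H →L[ℂ] H) :=
  ⟨0, 0, by simp, by simp⟩

lemma IsTraceClass.add {S T : H →L[ℂ] H} (hS : IsTraceClass S) (hT : IsTraceClass T) :
    IsTraceClass (S + T) := by
  obtain ⟨x, y, h, hx⟩ := hS
  obtain ⟨x', y', h', hx'⟩ := hT
  refine IsTraceClass.of_index (ι := ℕ ⊕ ℕ) (Sum.elim x x') (Sum.elim y y') ?_ ?_
  · exact (h.hasSum.sum (f := fun i : ℕ ⊕ ℕ => ‖Sum.elim x x' i‖ * ‖Sum.elim y y' i‖) h'.hasSum).summable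
  · exact hx.sum (f := fun i : ℕ ⊕ ℕ => rankOne ℂ (Sum.elim x x' i) (Sum.elim y y' i)) hx'

lemma IsTraceClass.mul_mul {T : H →L[ℂ] H} (hT : IsTraceClass T) (A B : H →L[ℂ] H) :
    IsTraceClass (A * T * B) := by
  obtain ⟨x, y, h, hx⟩ := hT
  refine ⟨fun n => A (x n), fun n => B.adjoint (y n), ?_, ?_⟩
  · refine Summable.of_nonneg_of_le (fun n => by positivity) (fun n => ?_)
      (h.mul_left (‖A‖ * ‖B.adjoint‖))
    calc _ ≤ (‖A‖ * ‖x n‖) * (‖B.adjoint‖ * ‖y n‖) :=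
          mul_le_mul (A.le_opNorm _) (B.adjoint.le_opNorm _) (by positivity) (by positivity)
      _ = _ := by ring
  · have := (hx.mul_left A).mul_right B
    refine this.congr_fun ?_
    intro n
    ext v
    simp [ContinuousLinearMap.adjoint_inner_left]

lemma IsTraceClass.rankOne (x y : H) : IsTraceClass (rankOne ℂ x y) :=
  IsTraceClass.of_index (ι := Unit) (fun _ => x) (fun _ => y) (.of_finite)
    (hasSum_unique fun _ : Unit => InnerProductSpace.rankOne ℂ x y)

variable (H) in
/-- The space of trace-class operators on `H`. -/
def TraceClass : Submodule ℂ (H →L[ℂ] H) where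
  carrier := {T | IsTraceClass T}
  add_mem' := IsTraceClass.add
  zero_mem' := IsTraceClass.zero
  smul_mem' c T hT := by
    simpa using hT.mul_mul (c • 1) 1

variable (H) in
/-- A fixed Hilbert basis (complete orthonormal system) of `H`. -/
def onb : HilbertBasis ↥(Classical.choose (exists_hilbertBasis ℂ H) : Set H) ℂ H :=
  Classical.choose (Classical.choose_spec (exists_hilbertBasis ℂ H))

/-- The trace `∑ᵢ ⟨eᵢ, T eᵢ⟩` of a trace-class operator. -/
def trace (T : H →L[ℂ] H) : ℂ := ∑' i, ⟪onb H i, T (onb H i)⟫_ℂ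

/-- The trace series converges and its sum does not depend on the orthonormal basis. -/
lemma hasSum_trace {κ : Type*} (b : HilbertBasis κ ℂ H) {T : H →L[ℂ] H} {x y : ℕ → H}
    (h : Summable fun n => ‖x n‖ * ‖y n‖) (hT : HasSum (fun n => InnerProductSpace.rankOne ℂ (x n) (y n)) T) :
    HasSum (fun k => ⟪b k, T (b k)⟫_ℂ) (∑' n, ⟪y n, x n⟫_ℂ) := by
  have hF : Summable fun q : ℕ × κ => ⟪y q.1, b q.2⟫_ℂ * ⟪b q.2, x q.1⟫_ℂ := by
    refine Summable.of_norm ?_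
    have hb : ∀ n (s : Finset κ), ∑ k ∈ s, ‖⟪y n, b k⟫_ℂ * ⟪b k, x n⟫_ℂ‖ ≤ ‖x n‖ * ‖y n‖ := by
      intro n s
      have e1 := b.orthonormal.sum_inner_products_le (x n) (s := s)
      have e2 := b.orthonormal.sum_inner_products_le (y n) (s := s)
      calc ∑ k ∈ s, ‖⟪y n, b k⟫_ℂ * ⟪b k, x n⟫_ℂ‖
          = ∑ k ∈ s, ‖⟪b k, x n⟫_ℂ‖ * ‖⟪b k, y n⟫_ℂ‖ := by
            refine Finset.sum_congr rfl fun k _ => ?_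
            rw [norm_mul, norm_inner_symm (y n), mul_comm]
        _ ≤ √(∑ k ∈ s, ‖⟪b k, x n⟫_ℂ‖ ^ 2) * √(∑ k ∈ s, ‖⟪b k, y n⟫_ℂ‖ ^ 2) :=
            Real.sum_mul_le_sqrt_mul_sqrt _ _ _
        _ ≤ √(‖x n‖ ^ 2) * √(‖y n‖ ^ 2) := by gcongr
        _ = _ := by simp
    have hs1 : ∀ n, Summable fun k => ‖⟪y n, b k⟫_ℂ * ⟪b k, x n⟫_ℂ‖ := fun n =>
      summable_of_sum_le (fun _ => norm_nonneg _) (hb n)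
    refine (summable_prod_of_nonneg (fun _ => norm_nonneg _)).2 ⟨hs1, ?_⟩
    exact Summable.of_nonneg_of_le (fun n => tsum_nonneg fun _ => norm_nonneg _)
      (fun n => (hs1 n).tsum_le_of_sum_le (hb n)) h
  have hk : ∀ k, HasSum (fun n => ⟪y n, b k⟫_ℂ * ⟪b k, x n⟫_ℂ) ⟪b k, T (b k)⟫_ℂ := by
    intro k
    have := (hT.mapL (ContinuousLinearMap.apply ℂ H (b k))).mapL (innerSL ℂ (b k))
    simpa [inner_smul_right] using this
  have hn : ∀ n, HasSum (fun k => ⟪y n, b k⟫_ℂ * ⟪b k, x n⟫_ℂ) ⟪y n, x n⟫_ℂ := fun n =>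
    b.hasSum_inner_mul_inner _ _
  have hF2 := hF.hasSum.prod_fiberwise hn
  rw [hF2.tsum_eq]
  exact ((Equiv.prodComm κ ℕ).hasSum_iff.2 hF.hasSum).prod_fiberwise hk

lemma IsTraceClass.trace_eq_tsum {κ : Type*} (b : HilbertBasis κ ℂ H) {T : H →L[ℂ] H}
    (hT : IsTraceClass T) : trace T = ∑' k, ⟪b k, T (b k)⟫_ℂ := by
  obtain ⟨x, y, h, hx⟩ := hT
  rw [(hasSum_trace b h hx).tsum_eq]
  exact (hasSum_trace (onb H) h hx).tsum_eq

/-- Density operators: positive trace-class operators of trace one. -/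
def IsState (ρ : TraceClass H) : Prop :=
  (ρ : H →L[ℂ] H).IsPositive ∧ trace (ρ : H →L[ℂ] H) = 1

/-- Positivity of an `n × n` block operator `(Tᵢⱼ)` with trace-class entries, as an operator
on `Hⁿ`. -/
def BlockPositive {n : ℕ} (T : Fin n → Fin n → TraceClass H) : Prop :=
  ∀ v : Fin n → H, 0 ≤ ∑ i, ∑ j, ⟪v i, (T i j : H →L[ℂ] H) (v j)⟫_ℂ

/-- Completely positive trace-preserving maps on the trace-class operators. -/
structure IsCPTP (Λ : TraceClass H →ₗ[ℂ] TraceClass H) : Prop where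
  completelyPositive : ∀ (n : ℕ) (T : Fin n → Fin n → TraceClass H),
    BlockPositive T → BlockPositive fun i j => Λ (T i j)
  tracePreserving : ∀ T : TraceClass H,
    trace (Λ T : H →L[ℂ] H) = trace (T : H →L[ℂ] H)

/-- The pure state `|φ⟩⟨φ|`. -/
def pureState (φ : H) : TraceClass H := ⟨InnerProductSpace.rankOne ℂ φ φ, .rankOne φ φ⟩

/-- The map `T ↦ K T K†` with Kraus operator `K`. -/
def krausMap (K : H →L[ℂ] H) : TraceClass H →ₗ[ℂ] TraceClass H where
  toFun T := ⟨K * T * K.adjoint, T.2.mul_mul _ _⟩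
  map_add' S T := by ext1; simp [mul_add, add_mul]
  map_smul' c T := by ext1; simp

end Abstract

section Twirl

variable {H : Type} [NormedAddCommGroup H] [InnerProductSpace ℂ H] [CompleteSpace H]

/-- For a bounded continuous `F : ℝ → H`, the operator `H → L²(ν)`, `w ↦ (p ↦ ⟨F p, w⟩)`. -/
def coeffOp (ν : Measure ℝ) [IsProbabilityMeasure ν] (F : ℝ → H) (hF : Continuous F) (a : ℝ)
    (ha : ∀ p, ‖F p‖ ≤ a) : H →L[ℂ] Lp ℂ 2 ν :=
  have hm : ∀ w, MemLp (fun p => ⟪F p, w⟫_ℂ) 2 ν := fun w =>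
    MemLp.of_bound (Continuous.aestronglyMeasurable (by fun_prop)) (a * ‖w‖)
      (.of_forall fun p => (norm_inner_le_norm _ _).trans (by gcongr; exact ha p))
  LinearMap.mkContinuous
    { toFun := fun w => (hm w).toLp _
      map_add' := fun v w => by
        rw [← MemLp.toLp_add]
        exact MemLp.toLp_congr _ _ (.of_forall fun p => by simp)
      map_smul' := fun c w => by
        rw [RingHom.id_apply, ← MemLp.toLp_const_smul]
        exact MemLp.toLp_congr _ _ (.of_forall fun p => by simp) }
    a fun w => by
      have h := Lp.norm_le_of_ae_bound (f := (hm w).toLp _) (C := a * ‖w‖)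
        (mul_nonneg ((norm_nonneg _).trans (ha 0)) (norm_nonneg _)) (by
          filter_upwards [(hm w).coeFn_toLp] with p hp
          rw [hp]
          exact (norm_inner_le_norm _ _).trans (by gcongr; exact ha p))
      simpa [measureUnivNNReal] using h

lemma coeffOp_ae (ν : Measure ℝ) [IsProbabilityMeasure ν] (F : ℝ → H) (hF : Continuous F) (a : ℝ)
    (ha : ∀ p, ‖F p‖ ≤ a) (w : H) :
    coeffOp ν F hF a ha w =ᵐ[ν] fun p => ⟪F p, w⟫_ℂ := by
  have hm : MemLp (fun p => ⟪F p, w⟫_ℂ) 2 ν :=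
    MemLp.of_bound (Continuous.aestronglyMeasurable (by fun_prop)) (a * ‖w‖)
      (.of_forall fun p => (norm_inner_le_norm _ _).trans (by gcongr; exact ha p))
  exact hm.coeFn_toLp

lemma coeffOp_adjoint_apply (ν : Measure ℝ) [IsProbabilityMeasure ν] (F G : ℝ → H)
    (hF : Continuous F) (hG : Continuous G) (a b : ℝ)
    (ha : ∀ p, ‖F p‖ ≤ a) (hb : ∀ p, ‖G p‖ ≤ b) (v : H) :
    (coeffOp ν F hF a ha).adjoint (coeffOp ν G hG b hb v) = ∫ p, ⟪G p, v⟫_ℂ • F p ∂ν := by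
  have hint : Integrable (fun p => ⟪G p, v⟫_ℂ • F p) ν := by
    refine Integrable.of_bound (Continuous.aestronglyMeasurable (by fun_prop)) (b * ‖v‖ * a)
      (.of_forall fun p => ?_)
    rw [norm_smul]
    have := (norm_nonneg _).trans (hb 0)
    exact mul_le_mul ((norm_inner_le_norm _ _).trans (by gcongr; exact hb p)) (ha p)
      (norm_nonneg _) (by positivity)
  refine ext_inner_left ℂ fun w => ?_
  rw [ContinuousLinearMap.adjoint_inner_right, L2.inner_def, ← integral_inner hint]
  refine integral_congr_ae ?_
  filter_upwards [coeffOp_ae ν F hF a ha w, coeffOp_ae ν G hG b hb v] with p h1 h2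
  rw [h1, h2, inner_smul_right]
  simp [mul_comm]

lemma coeffOp_hilbertSchmidt (ν : Measure ℝ) [IsProbabilityMeasure ν] (F : ℝ → H)
    (hF : Continuous F) (a : ℝ) (ha : ∀ p, ‖F p‖ ≤ a) {κ : Type*} {f : κ → Lp ℂ 2 ν}
    (hf : Orthonormal ℂ f) (s : Finset κ) :
    ∑ k ∈ s, ‖(coeffOp ν F hF a ha).adjoint (f k)‖ ^ 2 ≤ a ^ 2 := by
  set J := coeffOp ν F hF a ha with hJ
  have h1 : ∀ u : H, HasSum (fun i => ‖⟪onb H i, u⟫_ℂ‖ ^ 2) (‖u‖ ^ 2) := by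
    intro u
    have h := ((onb H).hasSum_inner_mul_inner u u).mapL Complex.reCLM
    have h2 : ∀ i, Complex.reCLM (⟪u, onb H i⟫_ℂ * ⟪onb H i, u⟫_ℂ) = ‖⟪onb H i, u⟫_ℂ‖ ^ 2 := by
      intro i
      rw [← inner_conj_symm u, RCLike.conj_mul, ← RCLike.ofReal_pow]
      exact Complex.ofReal_re _
    simp_rw [h2, inner_self_eq_norm_sq_to_K, ← RCLike.ofReal_pow] at h
    exact h
  refine le_of_tendsto (hasSum_sum fun k _ => h1 (J.adjoint (f k))) (.of_forall fun t => ?_)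
  have h2 : ∀ i ∈ t, ∑ k ∈ s, ‖⟪onb H i, J.adjoint (f k)⟫_ℂ‖ ^ 2
      ≤ ∫ p, ‖⟪F p, onb H i⟫_ℂ‖ ^ 2 ∂ν := by
    intro i _
    have h3 : ∑ k ∈ s, ‖⟪onb H i, J.adjoint (f k)⟫_ℂ‖ ^ 2
        = ∑ k ∈ s, ‖⟪f k, J (onb H i)⟫_ℂ‖ ^ 2 := by
      refine Finset.sum_congr rfl fun k _ => ?_
      rw [ContinuousLinearMap.adjoint_inner_right, norm_inner_symm]
    rw [h3]
    refine (hf.sum_inner_products_le _).trans (le_of_eq ?_)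
    have h4 : ((‖J (onb H i)‖ ^ 2 : ℝ) : ℂ) = ((∫ p, ‖⟪F p, onb H i⟫_ℂ‖ ^ 2 ∂ν : ℝ) : ℂ) := by
      refine Eq.trans ?_ (integral_ofReal (𝕜 := ℂ))
      have := inner_self_eq_norm_sq_to_K (𝕜 := ℂ) (J (onb H i))
      push_cast
      refine this.symm.trans ?_
      rw [L2.inner_def]
      refine integral_congr_ae ?_
      filter_upwards [coeffOp_ae ν F hF a ha (onb H i)] with p hp
      rw [hp, inner_self_eq_norm_sq_to_K]
    exact_mod_cast h4
  refine (Finset.sum_le_sum h2).trans ?_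
  rw [← integral_finsetSum]
  · refine (integral_mono_of_nonneg (.of_forall fun p => by positivity)
      (integrable_const (a ^ 2)) (.of_forall fun p => ?_)).trans (by simp)
    have h5 := (onb H).orthonormal.sum_inner_products_le (F p) (s := t)
    calc _ = ∑ i ∈ t, ‖⟪onb H i, F p⟫_ℂ‖ ^ 2 :=
          Finset.sum_congr rfl fun i _ => by rw [norm_inner_symm]
      _ ≤ ‖F p‖ ^ 2 := h5
      _ ≤ a ^ 2 := by gcongr; exact ha p
  · intro i _
    refine Integrable.of_bound (Continuous.aestronglyMeasurable (by fun_prop)) (a ^ 2)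
      (.of_forall fun p => ?_)
    have h6 := (onb H).orthonormal.1 i
    have : ‖⟪F p, onb H i⟫_ℂ‖ ≤ a := by
      refine (norm_inner_le_norm _ _).trans ?_
      rw [h6, mul_one]
      exact ha p
    rw [Real.norm_of_nonneg (by positivity)]
    gcongr

/-- The mixture `T ↦ ∫ U(p) T U(-p) dν(p)` for a strongly continuous family of contractions. -/
def twirl (ν : Measure ℝ) [IsProbabilityMeasure ν] (U : ℝ → H →L[ℂ] H)
    (hU : ∀ v, Continuous fun p => U p v) (hb : ∀ p, ‖U p‖ ≤ 1) :
    (H →L[ℂ] H) →L[ℂ] (H →L[ℂ] H) :=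
  have hn : ∀ (T : H →L[ℂ] H) (v : H) (p : ℝ), ‖U p (T (U (-p) v))‖ ≤ ‖T‖ * ‖v‖ :=
    fun T v p => by
      calc ‖U p (T (U (-p) v))‖ ≤ 1 * ‖T (U (-p) v)‖ := (U p).le_of_opNorm_le (hb p) _
        _ ≤ 1 * (‖T‖ * (1 * ‖v‖)) := by
          gcongr
          exact T.le_opNorm_of_le ((U (-p)).le_of_opNorm_le (hb _) _)
        _ = ‖T‖ * ‖v‖ := by ring
  have hc : ∀ (T : H →L[ℂ] H) (v : H), Continuous fun p => U p (T (U (-p) v)) := fun T v => by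
    refine continuous_iff_continuousAt.2 fun q => ?_
    have h1 : Filter.Tendsto (fun p => T (U (-p) v)) (nhds q) (nhds (T (U (-q) v))) :=
      ((T.continuous.comp (hU v)).comp continuous_neg).tendsto q
    have h2 := ((hU (T (U (-q) v))).tendsto q).add
      (squeeze_zero_norm (a := fun p => ‖T (U (-p) v) - T (U (-q) v)‖)
        (f := fun p => U p (T (U (-p) v) - T (U (-q) v))) (fun p => by
          simpa using (U p).le_of_opNorm_le (hb p) (T (U (-p) v) - T (U (-q) v)))
        (by simpa using (h1.sub_const (T (U (-q) v))).norm))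
    refine (h2.congr fun p => ?_).trans (by simp)
    simp
  have hi : ∀ (T : H →L[ℂ] H) (v : H), Integrable (fun p => U p (T (U (-p) v))) ν := fun T v =>
    Integrable.of_bound (hc T v).aestronglyMeasurable (‖T‖ * ‖v‖) (.of_forall (hn T v))
  have hle : ∀ (T : H →L[ℂ] H) (v : H), ‖∫ p, U p (T (U (-p) v)) ∂ν‖ ≤ ‖T‖ * ‖v‖ := fun T v => by
    simpa using norm_integral_le_of_norm_le_const (μ := ν) (.of_forall (hn T v))
  LinearMap.mkContinuous
    { toFun := fun T => LinearMap.mkContinuous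
        { toFun := fun v => ∫ p, U p (T (U (-p) v)) ∂ν
          map_add' := fun v w => by
            rw [← integral_add (hi T v) (hi T w)]
            simp
          map_smul' := fun c v => by
            rw [RingHom.id_apply, ← integral_smul]
            simp } ‖T‖ (hle T)
      map_add' := fun S T => by
        ext1 v
        exact (integral_congr_ae (.of_forall fun p => by simp)).trans
          (integral_add (hi S v) (hi T v))
      map_smul' := fun c T => by
        ext1 v
        exact (integral_congr_ae (.of_forall fun p => by simp)).trans
          (integral_smul c fun p => U p (T (U (-p) v))) }
    1 fun T => by
      rw [one_mul]
      exact LinearMap.mkContinuous_norm_le _ (norm_nonneg _) (hle T)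

lemma twirl_apply (ν : Measure ℝ) [IsProbabilityMeasure ν] (U : ℝ → H →L[ℂ] H)
    (hU : ∀ v, Continuous fun p => U p v) (hb : ∀ p, ‖U p‖ ≤ 1) (T : H →L[ℂ] H) (v : H) :
    twirl ν U hU hb T v = ∫ p, U p (T (U (-p) v)) ∂ν := rfl

lemma IsTraceClass.twirl (ν : Measure ℝ) [IsProbabilityMeasure ν] (U : ℝ → H →L[ℂ] H)
    (hU : ∀ v, Continuous fun p => U p v) (hb : ∀ p, ‖U p‖ ≤ 1)
    (hadj : ∀ p v w, ⟪U p v, w⟫_ℂ = ⟪v, U (-p) w⟫_ℂ) {T : H →L[ℂ] H} (hT : IsTraceClass T) :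
    IsTraceClass (PosCoh.twirl ν U hU hb T) := by
  obtain ⟨x, y, hs, hx⟩ := hT
  have hba : ∀ (u : H) (p : ℝ), ‖U p u‖ ≤ ‖u‖ := fun u p => by
    simpa using (U p).le_of_opNorm_le (hb p) u
  set J : H → H →L[ℂ] Lp ℂ 2 ν := fun u => coeffOp ν (fun p => U p u) (hU u) ‖u‖ (hba u) with hJ
  set f := onb (Lp ℂ 2 ν)
  have hfin : ∀ n (s : Finset _), ∑ k ∈ s, ‖(J (x n)).adjoint (f k)‖ * ‖(J (y n)).adjoint (f k)‖
      ≤ ‖x n‖ * ‖y n‖ := by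
    intro n s
    refine (Real.sum_mul_le_sqrt_mul_sqrt _ _ _).trans ?_
    gcongr <;>
    exact Real.sqrt_le_left (norm_nonneg _) |>.2
      (coeffOp_hilbertSchmidt ν _ _ _ _ f.orthonormal s)
  have hsk : ∀ n, Summable fun k => ‖(J (x n)).adjoint (f k)‖ * ‖(J (y n)).adjoint (f k)‖ :=
    fun n => summable_of_sum_le (fun _ => by positivity) (hfin n)
  have hsum : Summable fun q : ℕ × _ =>
      ‖(J (x q.1)).adjoint (f q.2)‖ * ‖(J (y q.1)).adjoint (f q.2)‖ :=
    (summable_prod_of_nonneg (fun _ => by positivity)).2 ⟨hsk,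
      Summable.of_nonneg_of_le (fun n => tsum_nonneg fun _ => by positivity)
      (fun n => (hsk n).tsum_le_of_sum_le (hfin n)) hs⟩
  refine IsTraceClass.of_index _ _ hsum ?_
  have hfib : ∀ n, HasSum (fun k => InnerProductSpace.rankOne ℂ ((J (x n)).adjoint (f k))
      ((J (y n)).adjoint (f k))) (PosCoh.twirl ν U hU hb (InnerProductSpace.rankOne ℂ (x n) (y n))) := by
    intro n
    refine hasSum_rankOne_of_apply (hsk n) fun v => ?_
    have h1 : PosCoh.twirl ν U hU hb (InnerProductSpace.rankOne ℂ (x n) (y n)) v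
        = (J (x n)).adjoint (J (y n) v) := by
      rw [hJ, coeffOp_adjoint_apply, twirl_apply]
      refine integral_congr_ae (.of_forall fun p => ?_)
      simp [hadj]
    rw [h1]
    have h2 := (f.hasSum_repr (J (y n) v)).mapL (J (x n)).adjoint
    simpa [f.repr_apply_apply, ContinuousLinearMap.adjoint_inner_left] using h2
  have hprod : Summable fun q : ℕ × _ => InnerProductSpace.rankOne ℂ ((J (x q.1)).adjoint (f q.2))
      ((J (y q.1)).adjoint (f q.2)) := Summable.of_norm (by simpa using hsum)
  have h3 := hprod.hasSum.prod_fiberwise hfib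
  rw [(hx.mapL (PosCoh.twirl ν U hU hb)).unique h3]
  exact hprod.hasSum

end Twirl

section Position

/-- The Hilbert space `L²(ℝ)` of wavefunctions on the line. -/
abbrev L2R : Type := Lp ℂ 2 (volume : Measure ℝ)

/-- Multiplication by a measurable function of modulus at most one. -/
def mulOp (f : ℝ → ℂ) (hf : Measurable f) (hb : ∀ x, ‖f x‖ ≤ 1) : L2R →L[ℂ] L2R :=
  have hle : ∀ (ψ : L2R) (x : ℝ), ‖f x * ψ x‖ ≤ ‖ψ x‖ := fun ψ x => by
    rw [norm_mul]
    exact mul_le_of_le_one_left (norm_nonneg _) (hb x)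
  have hm : ∀ ψ : L2R, MemLp (fun x => f x * ψ x) 2 volume := fun ψ =>
    (Lp.memLp ψ).of_le (hf.aestronglyMeasurable.mul (Lp.aestronglyMeasurable ψ))
      (.of_forall (hle ψ))
  LinearMap.mkContinuous
    { toFun := fun ψ => (hm ψ).toLp _
      map_add' := fun ψ χ => by
        rw [← MemLp.toLp_add]
        refine MemLp.toLp_congr _ _ ?_
        filter_upwards [Lp.coeFn_add ψ χ] with x hx
        rw [hx]
        exact mul_add _ _ _
      map_smul' := fun c ψ => by
        rw [RingHom.id_apply, ← MemLp.toLp_const_smul]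
        refine MemLp.toLp_congr _ _ ?_
        filter_upwards [Lp.coeFn_smul c ψ] with x hx
        simp [hx, mul_left_comm] }
    1 fun ψ => by
      rw [one_mul]
      refine Lp.norm_le_norm_of_ae_le ?_
      filter_upwards [(hm ψ).coeFn_toLp] with x hx
      exact (congrArg norm hx).le.trans (hle ψ x)

lemma mulOp_ae (f : ℝ → ℂ) (hf : Measurable f) (hb : ∀ x, ‖f x‖ ≤ 1) (ψ : L2R) :
    mulOp f hf hb ψ =ᵐ[volume] fun x => f x * ψ x := by
  have hm : MemLp (fun x => f x * ψ x) 2 volume :=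
    (Lp.memLp ψ).of_le (hf.aestronglyMeasurable.mul (Lp.aestronglyMeasurable ψ))
      (.of_forall fun x => by
        rw [norm_mul]
        exact mul_le_of_le_one_left (norm_nonneg _) (hb x))
  exact hm.coeFn_toLp

lemma norm_mulOp_le (f : ℝ → ℂ) (hf : Measurable f) (hb : ∀ x, ‖f x‖ ≤ 1) :
    ‖mulOp f hf hb‖ ≤ 1 := by
  refine ContinuousLinearMap.opNorm_le_bound _ zero_le_one fun ψ => ?_
  rw [one_mul]
  refine Lp.norm_le_norm_of_ae_le ?_
  filter_upwards [mulOp_ae f hf hb ψ] with x hx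
  rw [hx, norm_mul]
  exact mul_le_of_le_one_left (norm_nonneg _) (hb x)

/-- The projection `P_S`, multiplication by the indicator function of `S`. -/
def projOn (S : Set ℝ) (hS : MeasurableSet S) : L2R →L[ℂ] L2R :=
  mulOp (S.indicator 1) (measurable_one.indicator hS) fun x => by
    by_cases h : x ∈ S <;> simp [h]

/-- The translation `(V_a ψ)(x) = ψ(x - a)`. -/
def translation (a : ℝ) : L2R →L[ℂ] L2R :=
  (Lp.compMeasurePreservingₗᵢ ℂ (fun x : ℝ => x - a)
    (measurePreserving_sub_right volume a)).toContinuousLinearMap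

/-- The momentum kick `e^{i p X / ħ}`, multiplication by `x ↦ e^{i p x / ħ}`. -/
def kick (ħ p : ℝ) : L2R →L[ℂ] L2R :=
  mulOp (fun x => Complex.exp (((p * x / ħ : ℝ) : ℂ) * Complex.I)) (by fun_prop)
    fun x => (Complex.norm_exp_ofReal_mul_I _).le

lemma norm_kick_le (ħ p : ℝ) : ‖kick ħ p‖ ≤ 1 := norm_mulOp_le _ _ _

lemma inner_kick (ħ p : ℝ) (v w : L2R) : ⟪kick ħ p v, w⟫_ℂ = ⟪v, kick ħ (-p) w⟫_ℂ := by
  rw [L2.inner_def, L2.inner_def]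
  refine integral_congr_ae ?_
  filter_upwards [mulOp_ae _ _ _ v, mulOp_ae _ _ _ w] with x h1 h2
  rw [kick, h1, kick, h2]
  simp only [RCLike.inner_apply, map_mul, ← Complex.exp_conj, Complex.conj_ofReal, Complex.conj_I]
  have : ((-p * x / ħ : ℝ) : ℂ) * Complex.I = ((p * x / ħ : ℝ) : ℂ) * -Complex.I := by
    push_cast; ring
  rw [this]; ring

lemma continuous_kick (ħ : ℝ) (v : L2R) : Continuous fun p => kick ħ p v := by
  set c : ℝ → ℝ → ℂ := fun p x => Complex.exp (((p * x / ħ : ℝ) : ℂ) * Complex.I) with hc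
  have hc1 : ∀ p x, ‖c p x‖ = 1 := fun p x => Complex.norm_exp_ofReal_mul_I _
  have hv : Integrable (fun x => ‖v x‖ ^ 2) := (Lp.memLp v).integrable_norm_pow (by simp)
  refine continuous_iff_continuousAt.2 fun q => tendsto_iff_norm_sub_tendsto_zero.2 ?_
  have hsq : ∀ p, ‖kick ħ p v - kick ħ q v‖ ^ 2 = ∫ x, ‖(c p x - c q x) * v x‖ ^ 2 := by
    intro p
    have h4 : ((‖kick ħ p v - kick ħ q v‖ ^ 2 : ℝ) : ℂ)
        = ((∫ x, ‖(c p x - c q x) * v x‖ ^ 2 : ℝ) : ℂ) := by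
      refine Eq.trans ?_ (integral_ofReal (𝕜 := ℂ))
      push_cast
      refine (inner_self_eq_norm_sq_to_K (𝕜 := ℂ) (kick ħ p v - kick ħ q v)).symm.trans ?_
      rw [L2.inner_def]
      refine integral_congr_ae ?_
      filter_upwards [Lp.coeFn_sub (kick ħ p v) (kick ħ q v), mulOp_ae (c p) (by fun_prop)
        (fun x => (hc1 p x).le) v, mulOp_ae (c q) (by fun_prop) (fun x => (hc1 q x).le) v]
        with x h1 h2 h3
      have h5 : (kick ħ p v - kick ħ q v : L2R) x = (c p x - c q x) * v x := by
        rw [h1, sub_mul, ← h2, ← h3]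
        rfl
      rw [h5, inner_self_eq_norm_sq_to_K]
    exact_mod_cast h4
  have hcont : Continuous fun p => ∫ x, ‖(c p x - c q x) * v x‖ ^ 2 := by
    refine continuous_of_dominated (bound := fun x => 4 * ‖v x‖ ^ 2) (fun p => ?_) (fun p => ?_)
      (hv.const_mul 4) (.of_forall fun x => by fun_prop)
    · have : Measurable fun x => c p x - c q x := by fun_prop
      exact ((this.aestronglyMeasurable.mul (Lp.aestronglyMeasurable v)).norm).pow 2
    · refine .of_forall fun x => ?_
      have : ‖c p x - c q x‖ ≤ 2 := (norm_sub_le _ _).trans (by rw [hc1, hc1]; norm_num)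
      rw [Real.norm_of_nonneg (by positivity), norm_mul, mul_pow]
      gcongr
      nlinarith [norm_nonneg (c p x - c q x)]
  have h6 := (hcont.tendsto q).sqrt
  simp only [sub_self, zero_mul, norm_zero, ne_eq, OfNat.ofNat_ne_zero, not_false_eq_true,
    zero_pow, integral_zero, Real.sqrt_zero] at h6
  refine h6.congr fun p => ?_
  rw [← hsq, Real.sqrt_sq (norm_nonneg _)]

/-- The random-kick dephasing map
`Δ(T) = ∫ e^{i p X / ħ} T e^{- i p X / ħ} dν(p)` for the kick distribution `ν`. In the position
representation it multiplies a kernel `T(x, y)` by `g(x - y)`, where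
`g(ξ) = ∫ e^{i p ξ / ħ} dν(p)`. -/
def dephasing (ħ : ℝ) (ν : Measure ℝ) [IsProbabilityMeasure ν] :
    TraceClass L2R →ₗ[ℂ] TraceClass L2R where
  toFun T := ⟨twirl ν (kick ħ) (continuous_kick ħ) (norm_kick_le ħ) T,
    T.2.twirl ν _ _ _ (inner_kick ħ)⟩
  map_add' S T := by ext1; simp
  map_smul' c T := by ext1; simp

/-- The Hilbert–Schmidt dephasing loss `C₂(ρ) = Tr ρ² - Tr (Δ ρ)²`. -/
def dephasingLoss (ħ : ℝ) (ν : Measure ℝ) [IsProbabilityMeasure ν] (ρ : TraceClass L2R) : ℝ :=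
  (trace ((ρ : L2R →L[ℂ] L2R) ^ 2)
    - trace ((dephasing ħ ν ρ : L2R →L[ℂ] L2R) ^ 2)).re

/-- Dephasing-covariant operations: channels commuting with the dephasing map. -/
def DephasingCovariant (ħ : ℝ) (ν : Measure ℝ) [IsProbabilityMeasure ν] :
    Set (TraceClass L2R →ₗ[ℂ] TraceClass L2R) :=
  {Λ | IsCPTP Λ ∧ Λ ∘ₗ dephasing ħ ν = dephasing ħ ν ∘ₗ Λ}

/-- `C` does not increase on any state under any map in the class `F`. -/
def IsMonotoneUnder (C : TraceClass L2R → ℝ) (F : Set (TraceClass L2R →ₗ[ℂ] TraceClass L2R)) :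
    Prop :=
  ∀ Λ ∈ F, ∀ ρ, IsState ρ → C (Λ ρ) ≤ C ρ

/-- The translate `S + a`. -/
def shift (S : Set ℝ) (a : ℝ) : Set ℝ := (fun x => x - a) ⁻¹' S

lemma measurableSet_shift {S : Set ℝ} (hS : MeasurableSet S) (a : ℝ) :
    MeasurableSet (shift S a) := (measurable_id.sub_const a) hS

/-- The channel `ρ ↦ K_A ρ K_A† + K_B ρ K_B† + K₀ ρ K₀†` with `A = S + a`, `B = S + b`,
`K_A = V_{-a} P_A`, `K_B = V_{-b} P_B` and `K₀ = P_{(A ∪ B)ᶜ}`. -/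
def mergeChannel (S : Set ℝ) (hS : MeasurableSet S) (a b : ℝ) :
    TraceClass L2R →ₗ[ℂ] TraceClass L2R :=
  krausMap (translation (-a) * projOn (shift S a) (measurableSet_shift hS a))
    + krausMap (translation (-b) * projOn (shift S b) (measurableSet_shift hS b))
    + krausMap (projOn (shift S a ∪ shift S b)ᶜ
        ((measurableSet_shift hS a).union (measurableSet_shift hS b)).compl)

/-- The equal mixture of the translated pure states `V_a φ` and `V_b φ`. -/
def mixture (φ : L2R) (a b : ℝ) : TraceClass L2R :=
  (1 / 2 : ℂ) • pureState (translation a φ) + (1 / 2 : ℂ) • pureState (translation b φ)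

end Position

end PosCoh

end

open PosCoh MeasureTheory

noncomputable section

namespace PosCoh

open MeasureTheory InnerProductSpace
open scoped ComplexOrder InnerProductSpace

/-! ### Trace calculus for nuclear decompositions -/

section Abstract

variable {H : Type} [NormedAddCommGroup H] [InnerProductSpace ℂ H] [CompleteSpace H]

/-! The loss is quadratic in the state, so it is sensitive to classical mixing that a covariant
channel can undo. An equal mixture of two mutually orthogonal translates of `φ` has half the purity
of `φ`, before dephasing and also after it, since dephasing preserves the supports of the two pieces
and commutes with translations. Hence the mixture has exactly half the loss of `φ`
(`trace_sq_half_add_half`, `dephasingLoss_mixture`).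

The channel that detects in which region the particle sits and translates it back turns this mixture
into `φ` (`mergeChannel_mixture`). It is covariant because position projections commute with the
kicks, while a translation commutes with each kick up to a unimodular phase that cancels between `K`
and `K†` (`twirl_conj`, `mergeChannel_mem_dephasingCovariant`). So the channel doubles the loss, and
monotonicity fails as soon as some compactly supported `φ` has positive loss.

For positivity, the purity of the dephased pure state is the double integral of `‖⟪U p φ, U q φ⟫‖²`
against `ν ⊗ ν`. If distinct kicks never map `φ` to the same ray, the value 1 would force `ν` to be
a point mass (`trace_twirl_rankOne_sq_re_lt_one`). For the indicator of the unit interval the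
overlaps are values of a sinc function, of modulus below 1 away from the origin
(`norm_integral_exp_lt_one`). -/

lemma IsTraceClass.mul_left {T : H →L[ℂ] H} (hT : IsTraceClass T) (A : H →L[ℂ] H) :
    IsTraceClass (A * T) := by
  simpa using hT.mul_mul A 1

lemma IsTraceClass.summable_trace {T : H →L[ℂ] H} (hT : IsTraceClass T) :
    Summable fun i => ⟪onb H i, T (onb H i)⟫_ℂ := by
  obtain ⟨x, y, h, hx⟩ := hT
  exact (hasSum_trace (onb H) h hx).summable

lemma trace_add {S T : H →L[ℂ] H} (hS : IsTraceClass S) (hT : IsTraceClass T) :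
    trace (S + T) = trace S + trace T := by
  simp only [trace, add_apply, inner_add_right]
  exact hS.summable_trace.tsum_add hT.summable_trace

lemma trace_smul (c : ℂ) (T : H →L[ℂ] H) : trace (c • T) = c * trace T := by
  simp only [trace, smul_apply, inner_smul_right, tsum_mul_left]

lemma trace_eq_tsum_inner {T : H →L[ℂ] H} {x y : ℕ → H} (h : Summable fun n => ‖x n‖ * ‖y n‖)
    (hT : HasSum (fun n => InnerProductSpace.rankOne ℂ (x n) (y n)) T) :
    trace T = ∑' n, ⟪y n, x n⟫_ℂ :=
  (hasSum_trace (onb H) h hT).tsum_eq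

lemma trace_rankOne (x y : H) : trace (InnerProductSpace.rankOne ℂ x y) = ⟪y, x⟫_ℂ := by
  simp only [trace, InnerProductSpace.rankOne_apply, inner_smul_right]
  exact ((onb H).hasSum_inner_mul_inner y x).tsum_eq

/-- The trace of a Kraus conjugate, expanded in a nuclear decomposition of the operator. -/
lemma hasSum_trace_conj {T : H →L[ℂ] H} {x y : ℕ → H} (h : Summable fun n => ‖x n‖ * ‖y n‖)
    (hT : HasSum (fun n => InnerProductSpace.rankOne ℂ (x n) (y n)) T) (K : H →L[ℂ] H) :
    HasSum (fun n => ⟪K (y n), K (x n)⟫_ℂ) (trace (K * T * K.adjoint)) := by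
  have hs : Summable fun n => ‖K (x n)‖ * ‖K (y n)‖ := by
    refine Summable.of_nonneg_of_le (fun n => by positivity) (fun n => ?_)
      (h.mul_left (‖K‖ * ‖K‖))
    calc _ ≤ (‖K‖ * ‖x n‖) * (‖K‖ * ‖y n‖) :=
          mul_le_mul (K.le_opNorm _) (K.le_opNorm _) (by positivity) (by positivity)
      _ = _ := by ring
  have hsum : HasSum (fun n => InnerProductSpace.rankOne ℂ (K (x n)) (K (y n)))
      (K * T * K.adjoint) := by
    refine ((hT.mul_left K).mul_right K.adjoint).congr_fun fun n => ?_
    ext v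
    simp [ContinuousLinearMap.adjoint_inner_right]
  rw [trace_eq_tsum_inner hs hsum]
  refine (Summable.of_norm_bounded hs fun n => ?_).hasSum
  rw [mul_comm]
  exact norm_inner_le_norm _ _

/-- `K` need not be surjective: in a nuclear decomposition the trace is a sum of inner products, and
an isometry preserves each of them. -/
lemma trace_conj_of_inner_map {T K : H →L[ℂ] H} (hT : IsTraceClass T)
    (hK : ∀ v w, ⟪K v, K w⟫_ℂ = ⟪v, w⟫_ℂ) : trace (K * T * K.adjoint) = trace T := by
  obtain ⟨x, y, h, hx⟩ := hT
  rw [trace_eq_tsum_inner h hx, ← (hasSum_trace_conj h hx K).tsum_eq]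
  simp [hK]

/-! ### Kraus maps, pure states and mixtures -/

/-- Moving `K` across the inner product turns the test vectors `v i` into `K† (v i)`. -/
lemma blockPositive_krausMap (K : H →L[ℂ] H) {n : ℕ} {T : Fin n → Fin n → TraceClass H}
    (hT : BlockPositive T) : BlockPositive fun i j => krausMap K (T i j) := by
  intro v
  simpa [krausMap, ContinuousLinearMap.adjoint_inner_left] using hT fun i => K.adjoint (v i)

lemma BlockPositive.add {n : ℕ} {S T : Fin n → Fin n → TraceClass H} (hS : BlockPositive S)
    (hT : BlockPositive T) : BlockPositive fun i j => S i j + T i j := by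
  intro v
  have := add_nonneg (hS v) (hT v)
  simpa [inner_add_right, Finset.sum_add_distrib] using this

/-- A sum of three Kraus maps with `∑ K†K = 1` is completely positive and trace preserving. -/
lemma isCPTP_krausMap_add_three {K L M : H →L[ℂ] H}
    (h : ∀ v w, ⟪K v, K w⟫_ℂ + ⟪L v, L w⟫_ℂ + ⟪M v, M w⟫_ℂ = ⟪v, w⟫_ℂ) :
    IsCPTP (krausMap K + krausMap L + krausMap M) where
  completelyPositive n T hT :=
    ((blockPositive_krausMap K hT).add (blockPositive_krausMap L hT)).add
      (blockPositive_krausMap M hT)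
  tracePreserving T := by
    obtain ⟨x, y, hs, hx⟩ := T.2
    have h3 := ((hasSum_trace_conj hs hx K).add (hasSum_trace_conj hs hx L)).add
      (hasSum_trace_conj hs hx M)
    simp_rw [h] at h3
    rw [trace_eq_tsum_inner hs hx, h3.tsum_eq, ← trace_add (T.2.mul_mul _ _) (T.2.mul_mul _ _),
      ← trace_add ((T.2.mul_mul _ _).add (T.2.mul_mul _ _)) (T.2.mul_mul _ _)]
    rfl

lemma krausMap_pureState (K : H →L[ℂ] H) (φ : H) :
    krausMap K (pureState φ) = pureState (K φ) := by
  ext1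
  ext v
  simp [krausMap, pureState, ContinuousLinearMap.adjoint_inner_right]

lemma pureState_zero : pureState (0 : H) = 0 := by
  ext1
  simp [pureState]

lemma isState_half_add_half {φ χ : H} (hφ : ‖φ‖ = 1) (hχ : ‖χ‖ = 1) :
    IsState ((1 / 2 : ℂ) • pureState φ + (1 / 2 : ℂ) • pureState χ) := by
  have hc : (0 : ℂ) ≤ 1 / 2 := by
    rw [show (1 / 2 : ℂ) = ((1 / 2 : ℝ) : ℂ) by norm_num]
    exact_mod_cast (by norm_num : (0 : ℝ) ≤ 1 / 2)
  have ht : ∀ χ : H, ‖χ‖ = 1 → trace (pureState χ : H →L[ℂ] H) = 1 := fun χ h => by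
    simp [pureState, trace_rankOne, inner_self_eq_norm_sq_to_K, h]
  refine ⟨?_, ?_⟩
  · exact ((isPositive_rankOne_self φ).smul_of_nonneg hc).add
      ((isPositive_rankOne_self χ).smul_of_nonneg hc)
  · have : ((((1 / 2 : ℂ) • pureState φ + (1 / 2 : ℂ) • pureState χ : TraceClass H)) : H →L[ℂ] H)
        = (1 / 2 : ℂ) • (pureState φ : H →L[ℂ] H) + (1 / 2 : ℂ) • (pureState χ : H →L[ℂ] H) := rfl
    rw [this, trace_add (TraceClass H |>.smul_mem _ (pureState φ).2)
        (TraceClass H |>.smul_mem _ (pureState χ).2),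
      trace_smul, trace_smul, ht φ hφ, ht χ hχ]
    norm_num

/-- Trace of the square of an equal mixture of two orthogonal operators. -/
lemma trace_sq_half_add_half {X Y : H →L[ℂ] H} (hX : IsTraceClass X) (hY : IsTraceClass Y)
    (hXY : X * Y = 0) (hYX : Y * X = 0) :
    trace (((1 / 2 : ℂ) • X + (1 / 2 : ℂ) • Y) ^ 2) = 1 / 4 * (trace (X ^ 2) + trace (Y ^ 2)) := by
  have : ((1 / 2 : ℂ) • X + (1 / 2 : ℂ) • Y) ^ 2 = (1 / 4 : ℂ) • (X ^ 2 + Y ^ 2) := by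
    simp only [sq, mul_add, add_mul, smul_mul_smul_comm, hXY, hYX, smul_zero, add_zero, zero_add,
      smul_add]
    norm_num
  rw [this, trace_smul, trace_add]
  · rw [sq]; exact hX.mul_left X
  · rw [sq]; exact hY.mul_left Y

/-! ### Covariance and purity of the twirl -/

/-- Conjugation by an operator that commutes with `U p` up to a phase commutes with the mixture
over `p`. -/
lemma twirl_conj (ν : Measure ℝ) [IsProbabilityMeasure ν] (U : ℝ → H →L[ℂ] H)
    (hU : ∀ v, Continuous fun p => U p v) (hb : ∀ p, ‖U p‖ ≤ 1)
    (hadj : ∀ p v w, ⟪U p v, w⟫_ℂ = ⟪v, U (-p) w⟫_ℂ) {K : H →L[ℂ] H} {c : ℝ → ℂ}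
    (hc : ∀ p, ‖c p‖ = 1) (hK : ∀ p v, K (U p v) = c p • U p (K v)) (T : H →L[ℂ] H) :
    K * twirl ν U hU hb T * K.adjoint = twirl ν U hU hb (K * T * K.adjoint) := by
  -- Taking adjoints in `hK` conjugates the phase, so the two sides of `T` contribute `star (c p) *
  -- c p = 1`.
  have hKa : ∀ p v, U (-p) (K.adjoint v) = star (c p) • K.adjoint (U (-p) v) := by
    intro p v
    refine ext_inner_left ℂ fun w => ?_
    rw [← hadj, ContinuousLinearMap.adjoint_inner_right, hK, inner_smul_left, hadj,
      inner_smul_right, ContinuousLinearMap.adjoint_inner_right]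
    rfl
  ext v
  -- Only strong continuity is available and the argument of `U p` also varies: split it into its
  -- value at `q`, handled by `hU`, and a difference tending to zero, which the contraction `U p`
  -- cannot enlarge.
  have hcont : Continuous fun p => U p (T (U (-p) (K.adjoint v))) := by
    have hba : ∀ (u : H) (p : ℝ), ‖U p u‖ ≤ ‖u‖ := fun u p => by
      simpa using (U p).le_of_opNorm_le (hb p) u
    refine continuous_iff_continuousAt.2 fun q => ?_
    have h1 : Filter.Tendsto (fun p => T (U (-p) (K.adjoint v))) (nhds q)
        (nhds (T (U (-q) (K.adjoint v)))) :=
      ((T.continuous.comp (hU _)).comp continuous_neg).tendsto q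
    have h2 := ((hU (T (U (-q) (K.adjoint v)))).tendsto q).add
      (squeeze_zero_norm (fun p => hba (T (U (-p) (K.adjoint v)) - T (U (-q) (K.adjoint v))) p)
        (by simpa using (h1.sub_const (T (U (-q) (K.adjoint v)))).norm))
    refine (h2.congr fun p => ?_).trans (by simp)
    simp
  have hint : Integrable (fun p => U p (T (U (-p) (K.adjoint v)))) ν := by
    refine Integrable.of_bound hcont.aestronglyMeasurable (‖T‖ * ‖K.adjoint v‖)
      (.of_forall fun p => ?_)
    calc _ ≤ 1 * ‖T (U (-p) (K.adjoint v))‖ := (U p).le_of_opNorm_le (hb p) _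
      _ ≤ 1 * (‖T‖ * (1 * ‖K.adjoint v‖)) := by
        gcongr
        exact T.le_opNorm_of_le ((U (-p)).le_of_opNorm_le (hb _) _)
      _ = _ := by ring
  rw [mul_apply_eq_comp, mul_apply_eq_comp, twirl_apply, twirl_apply,
    ← K.integral_comp_comm hint]
  refine integral_congr_ae (.of_forall fun p => ?_)
  have h1 : starRingEnd ℂ (c p) * c p = 1 := by
    rw [RCLike.conj_mul, hc]
    norm_num
  simp [hKa, hK, smul_smul, h1]

lemma inner_twirl_rankOne_apply (ν : Measure ℝ) [IsProbabilityMeasure ν] (U : ℝ → H →L[ℂ] H)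
    (hU : ∀ v, Continuous fun p => U p v) (hb : ∀ p, ‖U p‖ ≤ 1)
    (hadj : ∀ p v w, ⟪U p v, w⟫_ℂ = ⟪v, U (-p) w⟫_ℂ) (φ v w : H) :
    ⟪w, twirl ν U hU hb (InnerProductSpace.rankOne ℂ φ φ) v⟫_ℂ
      = ∫ p, ⟪U p φ, v⟫_ℂ * ⟪w, U p φ⟫_ℂ ∂ν := by
  have hba : ∀ (p : ℝ), ‖U p φ‖ ≤ ‖φ‖ := fun p => by
    simpa using (U p).le_of_opNorm_le (hb p) φ
  have hcφ := hU φ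
  have hint : Integrable (fun p => ⟪U p φ, v⟫_ℂ • U p φ) ν := by
    refine Integrable.of_bound (Continuous.aestronglyMeasurable (by fun_prop))
      (‖φ‖ * ‖v‖ * ‖φ‖) (.of_forall fun p => ?_)
    rw [norm_smul]
    exact mul_le_mul ((norm_inner_le_norm _ _).trans (by gcongr; exact hba p)) (hba p)
      (norm_nonneg _) (by positivity)
  have h2 : twirl ν U hU hb (InnerProductSpace.rankOne ℂ φ φ) v
      = ∫ p, ⟪U p φ, v⟫_ℂ • U p φ ∂ν := by
    rw [twirl_apply]
    refine integral_congr_ae (.of_forall fun p => ?_)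
    simp [hadj]
  rw [h2, ← integral_inner hint]
  simp [inner_smul_right]

/-- Pairing the mixture of a pure state with a trace-class operator. -/
lemma trace_twirl_rankOne_mul (ν : Measure ℝ) [IsProbabilityMeasure ν] (U : ℝ → H →L[ℂ] H)
    (hU : ∀ v, Continuous fun p => U p v) (hb : ∀ p, ‖U p‖ ≤ 1)
    (hadj : ∀ p v w, ⟪U p v, w⟫_ℂ = ⟪v, U (-p) w⟫_ℂ) (φ : H) {T : H →L[ℂ] H}
    (hT : IsTraceClass T) :
    trace (twirl ν U hU hb (InnerProductSpace.rankOne ℂ φ φ) * T)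
      = ∫ p, ⟪U p φ, T (U p φ)⟫_ℂ ∂ν := by
  obtain ⟨x, y, hs, hx⟩ := hT
  set D := twirl ν U hU hb (InnerProductSpace.rankOne ℂ φ φ) with hD
  have hba : ∀ (p : ℝ), ‖U p φ‖ ≤ ‖φ‖ := fun p => by
    simpa using (U p).le_of_opNorm_le (hb p) φ
  have hsD : Summable fun n => ‖D (x n)‖ * ‖y n‖ := by
    refine Summable.of_nonneg_of_le (fun n => by positivity) (fun n => ?_) (hs.mul_left ‖D‖)
    rw [← mul_assoc]
    gcongr
    exact D.le_opNorm _
  have hxD : HasSum (fun n => InnerProductSpace.rankOne ℂ (D (x n)) (y n)) (D * T) := by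
    refine (hx.mul_left D).congr_fun fun n => ?_
    ext v
    simp
  have hcφ := hU φ
  have h1 : ∀ n, ⟪y n, D (x n)⟫_ℂ = ∫ p, ⟪U p φ, x n⟫_ℂ * ⟪y n, U p φ⟫_ℂ ∂ν := fun n =>
    inner_twirl_rankOne_apply ν U hU hb hadj φ (x n) (y n)
  have hbound : ∀ n p, ‖⟪U p φ, x n⟫_ℂ * ⟪y n, U p φ⟫_ℂ‖ ≤ ‖φ‖ ^ 2 * (‖x n‖ * ‖y n‖) := by
    intro n p
    rw [norm_mul]
    calc _ ≤ (‖φ‖ * ‖x n‖) * (‖y n‖ * ‖φ‖) :=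
          mul_le_mul ((norm_inner_le_norm _ _).trans (by gcongr; exact hba p))
            ((norm_inner_le_norm _ _).trans (by gcongr; exact hba p)) (norm_nonneg _)
            (by positivity)
      _ = _ := by ring
  have hmeas : ∀ n, AEStronglyMeasurable (fun p => ⟪U p φ, x n⟫_ℂ * ⟪y n, U p φ⟫_ℂ) ν :=
    fun n => Continuous.aestronglyMeasurable (by fun_prop)
  -- Sum and integral are interchanged: the bound `‖φ‖² ‖x n‖ ‖y n‖` is uniform in `p` and summable
  -- in `n`.
  have h4 : HasSum (fun n => ∫ p, ⟪U p φ, x n⟫_ℂ * ⟪y n, U p φ⟫_ℂ ∂ν)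
      (∫ p, ∑' n, ⟪U p φ, x n⟫_ℂ * ⟪y n, U p φ⟫_ℂ ∂ν) := by
    refine hasSum_integral_of_summable_integral_norm
      (fun n => Integrable.of_bound (hmeas n) _ (.of_forall (hbound n))) ?_
    refine Summable.of_nonneg_of_le (fun n => integral_nonneg fun p => norm_nonneg _) (fun n => ?_)
      (hs.mul_left (‖φ‖ ^ 2))
    refine (integral_mono_of_nonneg (.of_forall fun p => norm_nonneg _)
      (integrable_const _) (.of_forall (hbound n))).trans (by simp)
  rw [trace_eq_tsum_inner hsD hxD]
  simp_rw [h1]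
  rw [h4.tsum_eq]
  refine integral_congr_ae (.of_forall fun p => ?_)
  have h5 := (hx.mapL (ContinuousLinearMap.apply ℂ H (U p φ))).mapL (innerSL ℂ (U p φ))
  refine HasSum.tsum_eq ?_
  simpa [inner_smul_right, mul_comm] using h5

/-- With `v = U p φ` this is the inner integral of the double integral for the purity. -/
lemma inner_twirl_rankOne_self (ν : Measure ℝ) [IsProbabilityMeasure ν] (U : ℝ → H →L[ℂ] H)
    (hU : ∀ v, Continuous fun p => U p v) (hb : ∀ p, ‖U p‖ ≤ 1)
    (hadj : ∀ p v w, ⟪U p v, w⟫_ℂ = ⟪v, U (-p) w⟫_ℂ) (φ v : H) :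
    ⟪v, twirl ν U hU hb (InnerProductSpace.rankOne ℂ φ φ) v⟫_ℂ
      = ((∫ q, ‖⟪v, U q φ⟫_ℂ‖ ^ 2 ∂ν : ℝ) : ℂ) := by
  rw [inner_twirl_rankOne_apply ν U hU hb hadj, ← integral_complex_ofReal]
  refine integral_congr_ae (.of_forall fun p => ?_)
  beta_reduce
  rw [← inner_conj_symm (U p φ) v, RCLike.conj_mul]
  push_cast
  rfl

/-- A proper mixture over kicks that pairwise move `φ` off its ray has purity below one. -/
lemma trace_twirl_rankOne_sq_re_lt_one (ν : Measure ℝ) [IsProbabilityMeasure ν]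
    (hν : ∀ p : ℝ, ν ≠ Measure.dirac p) (U : ℝ → H →L[ℂ] H)
    (hU : ∀ v, Continuous fun p => U p v) (hb : ∀ p, ‖U p‖ ≤ 1)
    (hadj : ∀ p v w, ⟪U p v, w⟫_ℂ = ⟪v, U (-p) w⟫_ℂ) {φ : H} (hφ : ‖φ‖ = 1)
    (hlt : ∀ p q, p ≠ q → ‖⟪U p φ, U q φ⟫_ℂ‖ < 1) :
    (trace (twirl ν U hU hb (InnerProductSpace.rankOne ℂ φ φ) ^ 2)).re < 1 := by
  set D := twirl ν U hU hb (InnerProductSpace.rankOne ℂ φ φ) with hD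
  have hcφ := hU φ
  have hba : ∀ (p : ℝ), ‖U p φ‖ ≤ 1 := fun p => by
    simpa [hφ] using (U p).le_of_opNorm_le (hb p) φ
  have hle : ∀ p q, ‖⟪U p φ, U q φ⟫_ℂ‖ ^ 2 ≤ 1 := fun p q => by
    refine pow_le_one₀ (norm_nonneg _) ((norm_inner_le_norm _ _).trans ?_)
    exact mul_le_one₀ (hba p) (norm_nonneg _) (hba q)
  -- Equality case: if `f ≤ 1` averages to at least 1, then `f = 1` almost everywhere, so `q = p`
  -- for `ν`-almost every `q`. Pushing `ν` forward along the identity and along the constant `p`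
  -- then gives `ν = dirac p`.
  have lt_of_integral : ∀ f : ℝ → ℝ, Integrable f ν → (∀ p, f p ≤ 1) →
      (∃ p, ∀ᵐ q ∂ν, f q = 1 → q = p) → ∫ q, f q ∂ν < 1 := by
    rintro f hf h1 ⟨p, hp⟩
    by_contra! h
    have h0 : ∫ q, (1 - f q) ∂ν = 0 := by
      rw [integral_sub (integrable_const _) hf]
      have := integral_mono hf (integrable_const (1 : ℝ)) h1
      simp only [integral_const, probReal_univ, one_smul] at this ⊢
      linarith
    have h2 := (integral_eq_zero_iff_of_nonneg (fun q => sub_nonneg.2 (h1 q))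
      ((integrable_const _).sub hf)).1 h0
    have h3 : (fun q : ℝ => q) =ᵐ[ν] fun _ => p := by
      filter_upwards [h2, hp] with q h4 h5
      exact h5 (sub_eq_zero.1 h4).symm
    have h4 : ν.map (fun q : ℝ => q) = ν.map fun _ => p := Measure.map_congr h3
    rw [Measure.map_const, Measure.map_id', measure_univ, one_smul] at h4
    exact hν p h4
  have hinner : ∀ p, ∫ q, ‖⟪U p φ, U q φ⟫_ℂ‖ ^ 2 ∂ν < 1 := fun p => by
    refine lt_of_integral _ ?_ (hle p) ⟨p, .of_forall fun q hq => ?_⟩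
    · refine Integrable.of_bound (Continuous.aestronglyMeasurable (by fun_prop)) 1
        (.of_forall fun q => ?_)
      rw [Real.norm_of_nonneg (by positivity)]
      exact hle p q
    · by_contra hne
      have := pow_lt_one₀ (norm_nonneg _) (hlt p q (Ne.symm hne)) two_ne_zero
      exact this.ne hq
  have hD1 : IsTraceClass D := (IsTraceClass.rankOne φ φ).twirl ν U hU hb hadj
  rw [sq, hD, trace_twirl_rankOne_mul ν U hU hb hadj φ hD1]
  simp_rw [hD, inner_twirl_rankOne_self ν U hU hb hadj φ]
  rw [integral_complex_ofReal, Complex.ofReal_re]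
  -- The point 0 is arbitrary: the outer integrand is below 1 everywhere, so the condition on it is
  -- vacuous.
  refine lt_of_integral _ ?_ (fun p => (hinner p).le) ⟨0, .of_forall fun p hp => ?_⟩
  -- Continuity in the outer variable is read off the quadratic form of `D`, which avoids a
  -- parametric integral.
  · have hcont : Continuous fun p => (⟪U p φ, D (U p φ)⟫_ℂ).re := by fun_prop
    simp_rw [hD, inner_twirl_rankOne_self ν U hU hb hadj φ, Complex.ofReal_re] at hcont
    refine Integrable.of_bound hcont.aestronglyMeasurable 1 (.of_forall fun p => ?_)
    rw [Real.norm_of_nonneg (integral_nonneg fun q => by positivity)]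
    exact (hinner p).le
  · exact absurd hp (hinner p).ne

end Abstract

/-! ### Translations, kicks and projections on the line -/

section Position

lemma translation_ae (a : ℝ) (ψ : L2R) : translation a ψ =ᵐ[volume] fun x => ψ (x - a) :=
  Lp.coeFn_compMeasurePreserving ψ (measurePreserving_sub_right volume a)

lemma ae_comp_sub_right {p : ℝ → Prop} (h : ∀ᵐ x, p x) (a : ℝ) : ∀ᵐ x, p (x - a) :=
  (measurePreserving_sub_right volume a).quasiMeasurePreserving.ae h

lemma inner_translation (a : ℝ) (v w : L2R) : ⟪translation a v, translation a w⟫_ℂ = ⟪v, w⟫_ℂ :=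
  LinearIsometry.inner_map_map _ v w

lemma norm_translation (a : ℝ) (v : L2R) : ‖translation a v‖ = ‖v‖ :=
  LinearIsometry.norm_map _ v

lemma translation_neg_translation (a : ℝ) (v : L2R) : translation (-a) (translation a v) = v := by
  refine Lp.ext ?_
  filter_upwards [translation_ae (-a) (translation a v),
    ae_comp_sub_right (translation_ae a v) (-a)] with x h1 h2
  rw [h1, h2]
  simp

lemma kick_ae (ħ p : ℝ) (v : L2R) :
    kick ħ p v =ᵐ[volume] fun x => Complex.exp (((p * x / ħ : ℝ) : ℂ) * Complex.I) * v x :=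
  mulOp_ae _ _ _ v

/-- The Weyl commutation relation; the phase depends on `p` but not on the vector, as
`krausMap_dephasing` needs. -/
lemma translation_kick (ħ a p : ℝ) (v : L2R) :
    translation a (kick ħ p v)
      = Complex.exp (((-(p * a / ħ) : ℝ) : ℂ) * Complex.I) • kick ħ p (translation a v) := by
  refine Lp.ext ?_
  filter_upwards [translation_ae a (kick ħ p v), ae_comp_sub_right (kick_ae ħ p v) a,
    Lp.coeFn_smul (Complex.exp (((-(p * a / ħ) : ℝ) : ℂ) * Complex.I)) (kick ħ p (translation a v)),
    kick_ae ħ p (translation a v), translation_ae a v] with x h1 h2 h3 h4 h5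
  rw [h1, h2, h3, Pi.smul_apply, h4, h5, smul_eq_mul, ← mul_assoc, ← Complex.exp_add]
  congr 2
  push_cast
  ring

lemma projOn_ae {S : Set ℝ} (hS : MeasurableSet S) (v : L2R) :
    projOn S hS v =ᵐ[volume] fun x => S.indicator 1 x * v x :=
  mulOp_ae _ _ _ v

lemma projOn_kick (ħ p : ℝ) {S : Set ℝ} (hS : MeasurableSet S) (v : L2R) :
    projOn S hS (kick ħ p v) = kick ħ p (projOn S hS v) := by
  refine Lp.ext ?_
  filter_upwards [projOn_ae hS (kick ħ p v), kick_ae ħ p v, kick_ae ħ p (projOn S hS v),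
    projOn_ae hS v] with x h1 h2 h3 h4
  rw [h1, h2, h3, h4, mul_left_comm]

lemma projOn_eq_self {S : Set ℝ} (hS : MeasurableSet S) {v : L2R}
    (hv : ∀ᵐ x, x ∉ S → v x = 0) : projOn S hS v = v := by
  refine Lp.ext ?_
  filter_upwards [projOn_ae hS v, hv] with x h1 h2
  rw [h1]
  by_cases h : x ∈ S
  · simp [h]
  · simp [h2 h]

lemma projOn_eq_zero {S : Set ℝ} (hS : MeasurableSet S) {v : L2R}
    (hv : ∀ᵐ x, x ∈ S → v x = 0) : projOn S hS v = 0 := by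
  refine Lp.ext ?_
  filter_upwards [projOn_ae hS v, hv, Lp.coeFn_zero ℂ 2 (volume : Measure ℝ)] with x h1 h2 h3
  rw [h1, h3]
  by_cases h : x ∈ S
  · simp [h2 h]
  · simp [h]

lemma projOn_apply_eq_zero {S : Set ℝ} (hS : MeasurableSet S) (v : L2R) :
    ∀ᵐ x, x ∉ S → projOn S hS v x = 0 := by
  filter_upwards [projOn_ae hS v] with x h1 h
  simp [h1, h]

lemma projOn_projOn {S : Set ℝ} (hS : MeasurableSet S) (v : L2R) :
    projOn S hS (projOn S hS v) = projOn S hS v :=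
  projOn_eq_self hS (projOn_apply_eq_zero hS v)

lemma projOn_mul_projOn_of_disjoint {S T : Set ℝ} (hS : MeasurableSet S) (hT : MeasurableSet T)
    (h : Disjoint S T) : projOn S hS * projOn T hT = 0 := by
  ext1 v
  refine projOn_eq_zero hS ?_
  filter_upwards [projOn_apply_eq_zero hT v] with x h1 h2
  exact h1 (h.notMem_of_mem_left h2)

lemma inner_projOn {S : Set ℝ} (hS : MeasurableSet S) (v w : L2R) :
    ⟪projOn S hS v, w⟫_ℂ = ⟪v, projOn S hS w⟫_ℂ := by
  rw [L2.inner_def, L2.inner_def]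
  refine integral_congr_ae ?_
  filter_upwards [projOn_ae hS v, projOn_ae hS w] with x h1 h2
  rw [h1, h2]
  by_cases h : x ∈ S <;> simp [h]

lemma adjoint_projOn {S : Set ℝ} (hS : MeasurableSet S) :
    (projOn S hS).adjoint = projOn S hS :=
  ((ContinuousLinearMap.eq_adjoint_iff _ _).2 (inner_projOn hS)).symm

lemma projOn_add_projOn_add_projOn_compl {A B : Set ℝ} (hA : MeasurableSet A)
    (hB : MeasurableSet B) (h : Disjoint A B) (v : L2R) :
    projOn A hA v + projOn B hB v + projOn (A ∪ B)ᶜ (hA.union hB).compl v = v := by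
  refine Lp.ext ?_
  filter_upwards [Lp.coeFn_add (projOn A hA v + projOn B hB v)
    (projOn (A ∪ B)ᶜ (hA.union hB).compl v), Lp.coeFn_add (projOn A hA v) (projOn B hB v),
    projOn_ae hA v, projOn_ae hB v, projOn_ae (hA.union hB).compl v] with x h1 h2 h3 h4 h5
  rw [h1, Pi.add_apply, h2, Pi.add_apply, h3, h4, h5]
  by_cases hxA : x ∈ A
  · have := h.notMem_of_mem_left hxA
    simp [hxA, this]
  · by_cases hxB : x ∈ B <;> simp [hxA, hxB]

lemma translation_apply_eq_zero {φ : L2R} {S : Set ℝ} (hφ : ∀ᵐ x, x ∉ S → φ x = 0) (a : ℝ) :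
    ∀ᵐ x, x ∉ shift S a → translation a φ x = 0 := by
  filter_upwards [translation_ae a φ, ae_comp_sub_right hφ a] with x h1 h2 h3
  rw [h1]
  exact h2 h3

lemma coe_krausMap (K : L2R →L[ℂ] L2R) (T : TraceClass L2R) :
    (krausMap K T : L2R →L[ℂ] L2R) = K * T * K.adjoint :=
  rfl

lemma krausMap_dephasing (ħ : ℝ) (ν : Measure ℝ) [IsProbabilityMeasure ν] {K : L2R →L[ℂ] L2R}
    {c : ℝ → ℂ} (hc : ∀ p, ‖c p‖ = 1) (hK : ∀ p v, K (kick ħ p v) = c p • kick ħ p (K v))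
    (T : TraceClass L2R) : krausMap K (dephasing ħ ν T) = dephasing ħ ν (krausMap K T) := by
  ext1
  exact twirl_conj ν _ (continuous_kick ħ) (norm_kick_le ħ) (inner_kick ħ) hc hK T

lemma krausMap_translation_dephasing (ħ : ℝ) (ν : Measure ℝ) [IsProbabilityMeasure ν] (a : ℝ)
    (T : TraceClass L2R) :
    krausMap (translation a) (dephasing ħ ν T) = dephasing ħ ν (krausMap (translation a) T) :=
  krausMap_dephasing ħ ν (fun _ => Complex.norm_exp_ofReal_mul_I _) (translation_kick ħ a) T

lemma krausMap_projOn_dephasing (ħ : ℝ) (ν : Measure ℝ) [IsProbabilityMeasure ν] {S : Set ℝ}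
    (hS : MeasurableSet S) (T : TraceClass L2R) :
    krausMap (projOn S hS) (dephasing ħ ν T) = dephasing ħ ν (krausMap (projOn S hS) T) :=
  krausMap_dephasing ħ ν (c := 1) (by simp) (fun p v => by simp [projOn_kick]) T

lemma krausMap_mul (K L : L2R →L[ℂ] L2R) (T : TraceClass L2R) :
    krausMap (K * L) T = krausMap K (krausMap L T) := by
  ext1
  simp only [coe_krausMap, mul_assoc]
  congr 3
  exact ContinuousLinearMap.adjoint_comp K L

/-! ### The merging channel and the doubling of the loss -/

lemma mergeChannel_mem_dephasingCovariant (ħ : ℝ) (ν : Measure ℝ) [IsProbabilityMeasure ν]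
    {S : Set ℝ} (hS : MeasurableSet S) {a b : ℝ} (hab : Disjoint (shift S a) (shift S b)) :
    mergeChannel S hS a b ∈ DephasingCovariant ħ ν := by
  have hA := measurableSet_shift hS a
  have hB := measurableSet_shift hS b
  have hp : ∀ {T : Set ℝ} (hT : MeasurableSet T) (v w : L2R),
      ⟪projOn T hT v, projOn T hT w⟫_ℂ = ⟪v, projOn T hT w⟫_ℂ := fun hT v w => by
    rw [inner_projOn, projOn_projOn]
  refine ⟨isCPTP_krausMap_add_three fun v w => ?_, LinearMap.ext fun T => ?_⟩
  -- The translations are isometric and drop out of `K† K`, leaving three projections that resolve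
  -- the identity.
  · simp only [mul_apply_eq_comp, inner_translation, hp]
    rw [← inner_add_right, ← inner_add_right, projOn_add_projOn_add_projOn_compl hA hB hab]
  · simp only [mergeChannel, LinearMap.comp_apply, LinearMap.add_apply, map_add, krausMap_mul,
      krausMap_projOn_dephasing, krausMap_translation_dephasing]

/-- Each translate survives exactly one Kraus operator, which carries it back to `φ`; the two halves
then add up. -/
lemma mergeChannel_mixture {φ : L2R} {S : Set ℝ} (hS : MeasurableSet S) {a b : ℝ}
    (hφ : ∀ᵐ x, x ∉ S → φ x = 0) (hab : Disjoint (shift S a) (shift S b)) :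
    mergeChannel S hS a b (mixture φ a b) = pureState φ := by
  have hA := measurableSet_shift hS a
  have hB := measurableSet_shift hS b
  have ha := translation_apply_eq_zero hφ a
  have hb := translation_apply_eq_zero hφ b
  have h1 : projOn _ hB (translation a φ) = 0 := projOn_eq_zero hB <| by
    filter_upwards [ha] with x hx h
    exact hx (hab.notMem_of_mem_right h)
  have h2 : projOn _ hA (translation b φ) = 0 := projOn_eq_zero hA <| by
    filter_upwards [hb] with x hx h
    exact hx (hab.notMem_of_mem_left h)
  have h3 : projOn _ (hA.union hB).compl (translation a φ) = 0 := projOn_eq_zero _ <| by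
    filter_upwards [ha] with x hx h
    exact hx fun h' => h (Or.inl h')
  have h4 : projOn _ (hA.union hB).compl (translation b φ) = 0 := projOn_eq_zero _ <| by
    filter_upwards [hb] with x hx h
    exact hx fun h' => h (Or.inr h')
  simp only [mergeChannel, mixture, map_add, map_smul, LinearMap.add_apply, krausMap_pureState,
    mul_apply_eq_comp, projOn_eq_self hA ha, projOn_eq_self hB hb, h1, h2, h3, h4, map_zero,
    pureState_zero, translation_neg_translation, add_zero, zero_add]
  rw [← add_smul]
  norm_num

lemma trace_krausMap_translation_sq (a : ℝ) (T : TraceClass L2R) :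
    trace ((krausMap (translation a) T : L2R →L[ℂ] L2R) ^ 2)
      = trace ((T : L2R →L[ℂ] L2R) ^ 2) := by
  have h1 : (translation a).adjoint * translation a = 1 := by
    ext1 v
    refine ext_inner_left ℂ fun w => ?_
    rw [mul_apply_eq_comp, ContinuousLinearMap.adjoint_inner_right, inner_translation]
    rfl
  have h2 : (krausMap (translation a) T : L2R →L[ℂ] L2R) ^ 2
      = translation a * ((T : L2R →L[ℂ] L2R) ^ 2) * (translation a).adjoint := by
    rw [coe_krausMap, sq, sq]
    calc _ = translation a * T * ((translation a).adjoint * translation a) * T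
          * (translation a).adjoint := by simp only [mul_assoc]
      _ = _ := by rw [h1]; simp only [mul_assoc, one_mul]
  rw [h2, trace_conj_of_inner_map _ (inner_translation a)]
  rw [sq]
  exact T.2.mul_left _

/-- Both terms of the loss halve: the weights contribute `1/4`, the cross terms vanish, and the two
remaining traces agree by translation invariance. -/
lemma dephasingLoss_mixture (ħ : ℝ) (ν : Measure ℝ) [IsProbabilityMeasure ν] {φ : L2R} {S : Set ℝ}
    (hS : MeasurableSet S) {a b : ℝ} (hφ : ∀ᵐ x, x ∉ S → φ x = 0)
    (hab : Disjoint (shift S a) (shift S b)) :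
    dephasingLoss ħ ν (pureState φ) = 2 * dephasingLoss ħ ν (mixture φ a b) := by
  have hA := measurableSet_shift hS a
  have hB := measurableSet_shift hS b
  have hPa : krausMap (projOn _ hA) (pureState (translation a φ)) = pureState (translation a φ) := by
    rw [krausMap_pureState, projOn_eq_self hA (translation_apply_eq_zero hφ a)]
  have hPb : krausMap (projOn _ hB) (pureState (translation b φ)) = pureState (translation b φ) := by
    rw [krausMap_pureState, projOn_eq_self hB (translation_apply_eq_zero hφ b)]
  -- Orthogonality is phrased through invariance under compression, a property that dephasing
  -- preserves, so one argument serves both terms of the loss.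
  have hortho : ∀ {A B : Set ℝ} (hA : MeasurableSet A) (hB : MeasurableSet B) (_ : Disjoint A B)
      (X Y : TraceClass L2R), krausMap (projOn A hA) X = X → krausMap (projOn B hB) Y = Y →
        (X : L2R →L[ℂ] L2R) * Y = 0 := by
    intro A B hA hB h X Y hX hY
    rw [← hX, ← hY, coe_krausMap, coe_krausMap, adjoint_projOn, adjoint_projOn]
    calc _ = projOn A hA * X * (projOn A hA * projOn B hB) * Y * projOn B hB := by
          simp only [mul_assoc]
      _ = 0 := by simp [projOn_mul_projOn_of_disjoint hA hB h]
  have hsq : ∀ X Y : TraceClass L2R, krausMap (projOn _ hA) X = X → krausMap (projOn _ hB) Y = Y →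
      trace ((((1 / 2 : ℂ) • X + (1 / 2 : ℂ) • Y : TraceClass L2R) : L2R →L[ℂ] L2R) ^ 2)
        = 1 / 4 * (trace ((X : L2R →L[ℂ] L2R) ^ 2) + trace ((Y : L2R →L[ℂ] L2R) ^ 2)) :=
    fun X Y hX hY => trace_sq_half_add_half X.2 Y.2 (hortho hA hB hab X Y hX hY)
      (hortho hB hA hab.symm Y X hY hX)
  have ht : ∀ c, trace ((pureState (translation c φ) : L2R →L[ℂ] L2R) ^ 2)
      = trace ((pureState φ : L2R →L[ℂ] L2R) ^ 2) := fun c => by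
    rw [← krausMap_pureState, trace_krausMap_translation_sq]
  have hd : ∀ c, trace ((dephasing ħ ν (pureState (translation c φ)) : L2R →L[ℂ] L2R) ^ 2)
      = trace ((dephasing ħ ν (pureState φ) : L2R →L[ℂ] L2R) ^ 2) := fun c => by
    rw [← krausMap_pureState, ← krausMap_translation_dephasing, trace_krausMap_translation_sq]
  simp only [dephasingLoss, mixture, map_add, map_smul]
  rw [hsq _ _ hPa hPb, hsq _ _ (by rw [krausMap_projOn_dephasing, hPa])
    (by rw [krausMap_projOn_dephasing, hPb]), ht, ht, hd, hd]
  rw [← Complex.re_ofReal_mul]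
  congr 1
  push_cast
  ring

/-! ### Positive loss for the unit box -/

/-- The integral is `(exp (i t) - 1) / (i t)`, of modulus `2 |sin (t / 2)| / |t|`, and `|sin s| <
|s|` for `s ≠ 0`. -/
lemma norm_integral_exp_lt_one {t : ℝ} (ht : t ≠ 0) :
    ‖∫ x in (0 : ℝ)..1, Complex.exp (t * Complex.I * x)‖ < 1 := by
  have hc : (t : ℂ) * Complex.I ≠ 0 := by simp [ht]
  rw [integral_exp_mul_complex hc, norm_div, norm_mul, Complex.norm_I, Complex.norm_real, mul_one,
    div_lt_one (by positivity)]
  simp only [Complex.ofReal_one, Complex.ofReal_zero, mul_one, mul_zero, Complex.exp_zero]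
  rw [mul_comm, Complex.norm_exp_I_mul_ofReal_sub_one, norm_mul, Real.norm_eq_abs,
    Real.norm_eq_abs, Real.norm_eq_abs]
  have := Real.abs_sin_lt_abs (x := t / 2) (by simpa using ht)
  rw [abs_div] at this
  simp only [Nat.abs_ofNat] at this ⊢
  linarith

/-- The indicator function of the unit interval, as a unit vector. -/
def unitBox : L2R :=
  indicatorConstLp 2 (measurableSet_Icc (a := (0 : ℝ)) (b := 1)) (by simp) 1

lemma unitBox_ae : unitBox =ᵐ[volume] (Set.Icc (0 : ℝ) 1).indicator fun _ => 1 :=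
  indicatorConstLp_coeFn

lemma norm_unitBox : ‖unitBox‖ = 1 := by
  rw [unitBox, norm_indicatorConstLp (by simp) (by simp)]
  simp

/-- The overlap is the Fourier integral of the unit interval at frequency `(q - p) / ħ`. -/
lemma norm_inner_kick_unitBox_lt_one {ħ : ℝ} (hħ : 0 < ħ) {p q : ℝ} (hpq : p ≠ q) :
    ‖⟪kick ħ p unitBox, kick ħ q unitBox⟫_ℂ‖ < 1 := by
  have ht : (q - p) / ħ ≠ 0 := div_ne_zero (sub_ne_zero.2 hpq.symm) hħ.ne'
  convert norm_integral_exp_lt_one ht using 2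
  rw [intervalIntegral.integral_of_le zero_le_one, ← integral_Icc_eq_integral_Ioc,
    ← integral_indicator measurableSet_Icc, L2.inner_def]
  refine integral_congr_ae ?_
  filter_upwards [kick_ae ħ p unitBox, kick_ae ħ q unitBox,
    unitBox_ae] with x h1 h2 h3
  rw [h1, h2, h3]
  by_cases hx : x ∈ Set.Icc (0 : ℝ) 1
  · simp only [Set.indicator_of_mem hx, mul_one, RCLike.inner_apply, ← Complex.exp_conj, map_mul,
      Complex.conj_ofReal, Complex.conj_I, ← Complex.exp_add]
    congr 1
    push_cast
    ring
  · simp only [Set.indicator_of_notMem hx, mul_zero, inner_zero_left]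

lemma dephasingLoss_unitBox_pos {ħ : ℝ} (hħ : 0 < ħ) (ν : Measure ℝ) [IsProbabilityMeasure ν]
    (hν : ∀ p : ℝ, ν ≠ Measure.dirac p) : 0 < dephasingLoss ħ ν (pureState unitBox) := by
  have h1 := trace_twirl_rankOne_sq_re_lt_one ν hν _ (continuous_kick ħ) (norm_kick_le ħ)
    (inner_kick ħ) norm_unitBox fun p q => norm_inner_kick_unitBox_lt_one hħ
  have h2 : (pureState unitBox : L2R →L[ℂ] L2R) ^ 2 = pureState unitBox := by
    rw [sq]
    ext1 v
    simp [pureState, inner_self_eq_norm_sq_to_K, norm_unitBox]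
  have h3 : trace (pureState unitBox : L2R →L[ℂ] L2R) = 1 := by
    simp [pureState, trace_rankOne, inner_self_eq_norm_sq_to_K, norm_unitBox]
  rw [dephasingLoss, h2, h3, Complex.sub_re, Complex.one_re, sub_pos]
  exact h1

lemma disjoint_shift_unitInterval :
    Disjoint (shift (Set.Icc (0 : ℝ) 1) 0) (shift (Set.Icc (0 : ℝ) 1) 2) := by
  refine Set.disjoint_left.2 fun x h1 h2 => ?_
  simp only [shift, Set.mem_preimage, Set.mem_Icc] at h1 h2
  linarith [h1.2, h2.1]

end Position

end PosCoh

end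

open PosCoh MeasureTheory

theorem mainTheorem4 (ħ : ℝ) (hħ : 0 < ħ) (ν : Measure ℝ) [IsProbabilityMeasure ν]
    (hν : ∀ p : ℝ, ν ≠ Measure.dirac p) :
    ¬ IsMonotoneUnder (dephasingLoss ħ ν) (DephasingCovariant ħ ν) ∧
    (∀ (φ : L2R) (S : Set ℝ) (hS : MeasurableSet S) (a b : ℝ),
      ‖φ‖ = 1 → (∀ᵐ x, x ∉ S → φ x = 0) → Disjoint (shift S a) (shift S b) →
        mergeChannel S hS a b ∈ DephasingCovariant ħ ν ∧
        IsState (mixture φ a b) ∧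
        mergeChannel S hS a b (mixture φ a b) = pureState φ ∧
        dephasingLoss ħ ν (mergeChannel S hS a b (mixture φ a b))
          = 2 * dephasingLoss ħ ν (mixture φ a b)) ∧
    (∃ (φ : L2R) (c d a b : ℝ),
      ‖φ‖ = 1 ∧ (∀ᵐ x, x ∉ Set.Icc c d → φ x = 0) ∧
        Disjoint (shift (Set.Icc c d) a) (shift (Set.Icc c d) b) ∧
        0 < dephasingLoss ħ ν (pureState φ)) := by
  have hbox : ∀ᵐ x, x ∉ Set.Icc (0 : ℝ) 1 → unitBox x = 0 := indicatorConstLp_coeFn_notMem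
  have hpos := dephasingLoss_unitBox_pos hħ ν hν
  refine ⟨fun hmono => ?_, fun φ S hS a b hφ hsupp hab => ?_, ?_⟩
  · have h1 := hmono _ (mergeChannel_mem_dephasingCovariant ħ ν measurableSet_Icc
      disjoint_shift_unitInterval) (mixture unitBox 0 2)
      (isState_half_add_half (by rw [norm_translation, norm_unitBox])
        (by rw [norm_translation, norm_unitBox]))
    rw [mergeChannel_mixture measurableSet_Icc hbox disjoint_shift_unitInterval] at h1
    have h2 := dephasingLoss_mixture ħ ν measurableSet_Icc hbox disjoint_shift_unitInterval
    -- The loss of `unitBox` would be positive and at most half of itself.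
    linarith
  · refine ⟨mergeChannel_mem_dephasingCovariant ħ ν hS hab,
      isState_half_add_half (by rw [norm_translation, hφ]) (by rw [norm_translation, hφ]),
      mergeChannel_mixture hS hsupp hab, ?_⟩
    rw [mergeChannel_mixture hS hsupp hab]
    exact dephasingLoss_mixture ħ ν hS hsupp hab
  · exact ⟨unitBox, 0, 1, 0, 2, norm_unitBox, hbox, disjoint_shift_unitInterval, hpos⟩
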